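/- Consider the $K$-armed bandit game over $T$ rounds with a fixed sequence of loss vectors $\ell_{1:T}=(\ell_{i,t})_{1\le i\le K,\,1\le t\le T}\in[0,1]^{KT}$. A randomised bandit algorithm chooses in each round $t$, from the history $(I_s,\ell_{I_s,s})_{1\le s\le t-1}$ and possibly from internal randomisation, a probability distribution $p_t$ on $\{1,\dots,K\}$, draws an arm $I_t$ from $p_t$, and then observes only the loss $\ell_{I_t,t}$. Write $$L^*_T=\min_{1\le i\le K}\sum_{t=1}^T\ell_{i,t},\qquad R_T(\ell_{1:T})=\sum_{t=1}^T\ell_{I_t,t}-L^*_T,\qquad \mathcal{B}_{\alpha,T}=\Bigl\{\ell_{1:T}\in[0,1]^{KT}:\ \frac{L^*_T}{T}\le\alpha\Bigr\}.$$ Let $K\ge 2$ and $T\ge \max\{K,118\}$ be integers, and let $$\alpha\in\left[\frac{\max\{\tfrac{64}{9}\log(32T),\,K/2\}}{T},\ \frac12\right].$$ Then for every randomised bandit algorithm $$\sup_{\ell_{1:T}\in\mathcal{B}_{\alpha,T}}\mathbb{E}\bigl[R_T(\ell_{1:T})\bigr]\ \ge\ \frac{1}{27}\sqrt{\alpha T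 K},$$ where the expectation is taken with respect to the internal randomisation of the algorithm. -/

import Mathlib

open MeasureTheory

noncomputable section

namespace Bandit

/-- A loss sequence `ℓ` over `T` rounds and `K` arms: `ℓ t i ∈ [0,1]` is the loss of arm `i`
in round `t`. -/
abbrev LossSeq (K T : ℕ) : Type := Fin T → Fin K → unitInterval

/-- What the learner has seen after `t` rounds: for each of them the arm that was played and the
loss of that arm (and of no other arm). -/
abbrev History (K t : ℕ) : Type := Fin t → Fin K × unitInterval

/-- A randomised bandit algorithm with `K` arms. It may use an internal random seed `ω`, drawn once
from an arbitrary probability space. After `t` rounds with history `h` it forms the probability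
vector `weight t ω h` on the arms and draws its next arm from it.
The case of weights that depend on the history only (no seed) is that of a one-point `Ω`, and the
case where all the randomness is in the seed is that of Dirac weights. -/
structure RandomisedAlgorithm (K : ℕ) where
  /-- the space of seeds -/
  Ω : Type*
  [measurableSpace : MeasurableSpace Ω]
  /-- the law of the seed -/
  P : Measure Ω
  [isProbabilityMeasure : IsProbabilityMeasure P]
  /-- the probability vector from which the next arm is drawn after `t` rounds -/
  weight : (t : ℕ) → Ω → History K t → Fin K → ℝ
  weight_nonneg : ∀ t ω h i, 0 ≤ weight t ω h i
  weight_sum : ∀ t ω h, ∑ i, weight t ω h i = 1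
  weight_measurable : ∀ t h i, Measurable fun ω => weight t ω h i

attribute [instance] RandomisedAlgorithm.measurableSpace RandomisedAlgorithm.isProbabilityMeasure

variable {K T : ℕ}

/-- The cumulative loss of the best arm, `L*_T = min_i ∑_t ℓ_{i,t}`. -/
def bestLoss (ℓ : LossSeq K T) : ℝ := ⨅ i : Fin K, ∑ t, (ℓ t i : ℝ)

/-- The regret `R_T` on `ℓ` when the arms played are `a 0, …, a (T - 1)`. -/
def regret (ℓ : LossSeq K T) (a : Fin T → Fin K) : ℝ := ∑ t, (ℓ t (a t) : ℝ) - bestLoss ℓ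

/-- The history available at the beginning of round `t` (rounds are counted from `0`) when the
losses are `ℓ` and the arms played are `a`. -/
def history (ℓ : LossSeq K T) (a : Fin T → Fin K) (t : Fin T) : History K t :=
  fun s => (a (s.castLE t.isLt.le), ℓ (s.castLE t.isLt.le) (a (s.castLE t.isLt.le)))

/-- The probability, given the seed `ω`, that the algorithm plays exactly the arms `a` when the
losses are `ℓ`: the product over the rounds of the conditional probabilities of the arm played. -/
def RandomisedAlgorithm.playProb (A : RandomisedAlgorithm K) (ℓ : LossSeq K T) (ω : A.Ω)
    (a : Fin T → Fin K) : ℝ :=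
  ∏ t : Fin T, A.weight t ω (history ℓ a t) (a t)

/-- The expected regret `𝔼[R_T(ℓ)]` on the fixed loss sequence `ℓ`; the expectation is over the
seed and over the draws of the arms. -/
def RandomisedAlgorithm.expectedRegret (A : RandomisedAlgorithm K) (ℓ : LossSeq K T) : ℝ :=
  ∫ ω, ∑ a : Fin T → Fin K, A.playProb ℓ ω a * regret ℓ a ∂A.P

/-- The small-loss ball: the loss sequences with `L*_T / T ≤ α`. -/
def smallLossBall (K T : ℕ) (α : ℝ) : Set (LossSeq K T) := {ℓ | bestLoss ℓ / T ≤ α}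

end Bandit

end

/-!
Let all losses be independent Bernoulli variables with mean `p = α / 2`, except that one planted arm
`i` has mean `q = p - gap`. Given the seed, the relative entropy between the observations without
and with the planted arm is the expected number of plays of `i` without it, times the relative
entropy of the two Bernoulli laws. As these expected numbers of plays sum to `T` over `i`, the Gibbs
variational principle shows that the plays of `i` with `i` planted add up to far less than `K * T`,
so the average regret over `i` is of order `gap * T`. Since `q ≤ α / 2`, a Chernoff bound makes the
loss of the planted arm exceed `α * T` with probability at most `1 / (32 * T)` only, so the loss
sequences outside the small-loss ball contribute at most `1 / 32` to the expected regret.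
-/

noncomputable section

namespace Bandit

section SequentialSampling

variable {X R : Type*} [CommSemiring R] {T : ℕ}

/-- The weight of the path `h` when its points are drawn one after the other, the point `h t` with
weights `κ t g` given that the `t` points before it are `g`. -/
def pathWeight (κ : (t : Fin T) → (Fin t → X) → X → R) (h : Fin T → X) : R :=
  ∏ t : Fin T, κ t (Fin.take t t.isLt.le h) (h t)

lemma pathWeight_nonneg [PartialOrder R] [IsOrderedRing R]
    {κ : (t : Fin T) → (Fin t → X) → X → R} (hκ : ∀ t g y, 0 ≤ κ t g y) (h : Fin T → X) :
    0 ≤ pathWeight κ h :=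
  Finset.prod_nonneg fun _ _ ↦ hκ _ _ _

variable [Fintype X]

lemma sum_pathWeight_succ_mul (κ : (t : Fin (T + 1)) → (Fin t → X) → X → R)
    (F : (Fin T → X) → X → R) :
    ∑ h, pathWeight κ h * F (Fin.init h) (h (Fin.last T)) =
      ∑ g, pathWeight (fun t : Fin T ↦ κ t.castSucc) g * ∑ y, κ (Fin.last T) g y * F g y := by
  rw [← (Fin.snocEquiv fun _ : Fin (T + 1) ↦ X).sum_comp, Fintype.sum_prod_type_right]
  refine Finset.sum_congr rfl fun g _ ↦ ?_
  rw [Finset.mul_sum]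
  refine Finset.sum_congr rfl fun y _ ↦ ?_
  have hinit : Fin.init (Fin.snocEquiv (fun _ ↦ X) (y, g)) = g := Fin.init_snoc (α := fun _ ↦ X) y g
  have hlast : Fin.snocEquiv (fun _ ↦ X) (y, g) (Fin.last T) = y :=
    Fin.snoc_last (α := fun _ ↦ X) y g
  have hsucc (h : Fin (T + 1) → X) : pathWeight κ h =
      pathWeight (fun t : Fin T ↦ κ t.castSucc) (Fin.init h) *
        κ (Fin.last T) (Fin.init h) (h (Fin.last T)) := Fin.prod_univ_castSucc _
  rw [hsucc, hinit, hlast, mul_assoc]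

lemma sum_pathWeight {κ : (t : Fin T) → (Fin t → X) → X → R} (hκ : ∀ t g, ∑ y, κ t g y = 1) :
    ∑ h, pathWeight κ h = 1 := by
  induction T with
  | zero => simp [pathWeight]
  | succ T ih =>
    simpa [hκ, ih fun t ↦ hκ t.castSucc] using sum_pathWeight_succ_mul κ fun _ _ ↦ 1

lemma sum_pathWeight_mul_sum_eq_condMean {κ : (t : Fin T) → (Fin t → X) → X → R}
    (hκ : ∀ t g, ∑ y, κ t g y = 1) (φ : (t : Fin T) → (Fin t → X) → X → R) :
    ∑ h, pathWeight κ h * ∑ t, φ t (Fin.take t t.isLt.le h) (h t) =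
      ∑ h, pathWeight κ h * ∑ t : Fin T,
        ∑ y, κ t (Fin.take t t.isLt.le h) y * φ t (Fin.take t t.isLt.le h) y := by
  induction T with
  | zero => simp
  | succ T ih =>
    have hsplit (ψ : (t : Fin (T + 1)) → (Fin t → X) → X → R) :
        ∑ h, pathWeight κ h * ∑ t, ψ t (Fin.take t t.isLt.le h) (h t) =
          ∑ g, pathWeight (fun t : Fin T ↦ κ t.castSucc) g *
              ∑ t : Fin T, ψ t.castSucc (Fin.take t t.isLt.le g) (g t) +
            ∑ g, pathWeight (fun t : Fin T ↦ κ t.castSucc) g *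
              ∑ y, κ (Fin.last T) g y * ψ (Fin.last T) g y := by
      simp_rw [Fin.sum_univ_castSucc]
      refine (sum_pathWeight_succ_mul κ fun g y ↦
        ∑ t : Fin T, ψ t.castSucc (Fin.take t t.isLt.le g) (g t) + ψ (Fin.last T) g y).trans ?_
      simp_rw [mul_add, Finset.sum_add_distrib, ← Finset.sum_mul, hκ, one_mul, mul_add,
        Finset.sum_add_distrib]
    rw [hsplit, hsplit fun t g _ ↦ ∑ y, κ t g y * φ t g y,
      ih (fun t ↦ hκ t.castSucc) fun t ↦ φ t.castSucc]
    simp_rw [← Finset.sum_mul, hκ, one_mul]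

end SequentialSampling

section ProductWeights

variable {ι τ Y R : Type*} [Fintype ι] [DecidableEq ι] [Fintype τ] [DecidableEq τ] [Fintype Y]
  [CommSemiring R]

lemma sum_prod_mul_comp {w : ι → Y → R} (hw : ∀ i, ∑ y, w i y = 1) {e : τ → ι}
    (he : Function.Injective e) (F : (τ → Y) → R) :
    ∑ v : ι → Y, (∏ i, w i (v i)) * F (v ∘ e) = ∑ x : τ → Y, (∏ t, w (e t) (x t)) * F x := by
  classical
  let σ : τ ⊕ ↥(Set.range e)ᶜ ≃ ι :=
    ((Equiv.ofInjective e he).sumCongr (Equiv.refl _)).trans (Equiv.Set.sumCompl (Set.range e))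
  let glue : (τ → Y) × (↥(Set.range e)ᶜ → Y) ≃ (ι → Y) :=
    (Equiv.sumArrowEquivProdArrow _ _ Y).symm.trans (σ.arrowCongr (Equiv.refl Y))
  have glue_apply (x : τ → Y) (z : ↥(Set.range e)ᶜ → Y) (s : τ ⊕ ↥(Set.range e)ᶜ) :
      glue (x, z) (σ s) = Sum.elim x z s := congrArg (Sum.elim x z) (σ.symm_apply_apply s)
  have glue_comp (x : τ → Y) (z : ↥(Set.range e)ᶜ → Y) : glue (x, z) ∘ e = x :=
    funext fun t ↦ glue_apply x z (Sum.inl t)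
  rw [← glue.sum_comp, Fintype.sum_prod_type]
  refine Finset.sum_congr rfl fun x _ ↦ ?_
  simp_rw [glue_comp, ← σ.prod_comp, glue_apply, Fintype.prod_sum_type, Sum.elim_inl, Sum.elim_inr,
    ← Finset.sum_mul, ← Finset.mul_sum]
  rw [← Fintype.prod_sum fun (j : ↥(Set.range e)ᶜ) y ↦ w (σ (Sum.inr j)) y]
  simp_rw [hw, Finset.prod_const_one, mul_one]
  rfl

end ProductWeights

section RelativeEntropy

variable {X : Type*} [Fintype X] {P Q : X → ℝ}

/-- The relative entropy (Kullback–Leibler divergence) of two weights on a finite type. Because of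
`Real.log 0 = 0` this is the usual notion only if `P` vanishes wherever `Q` does. -/
def relEntropy (P Q : X → ℝ) : ℝ := ∑ x, P x * Real.log (P x / Q x)

lemma relEntropy_self (P : X → ℝ) : relEntropy P P = 0 :=
  Finset.sum_eq_zero fun x _ ↦ by rcases eq_or_ne (P x) 0 with h | h <;> simp [h]

lemma sum_mul_add_one_le_relEntropy_add_sum_exp (hP : ∀ x, 0 ≤ P x) (hQ : ∀ x, 0 ≤ Q x)
    (hPQ : ∀ x, Q x = 0 → P x = 0) (hPsum : ∑ x, P x = 1) (g : X → ℝ) :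
    ∑ x, P x * g x + 1 ≤ relEntropy P Q + ∑ x, Q x * Real.exp (g x) := by
  rw [relEntropy, ← hPsum, ← Finset.sum_add_distrib, ← Finset.sum_add_distrib]
  refine Finset.sum_le_sum fun x _ ↦ ?_
  rcases (hP x).eq_or_lt with hx | hx
  · simpa [← hx] using mul_nonneg (hQ x) (Real.exp_pos (g x)).le
  have hQx : 0 < Q x := (hQ x).lt_of_ne' fun h ↦ hx.ne' (hPQ x h)
  have hexp : P x * Real.exp (g x - Real.log (P x / Q x)) = Q x * Real.exp (g x) := by
    rw [Real.exp_sub, Real.exp_log (div_pos hx hQx)]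
    field_simp
  have := mul_le_mul_of_nonneg_left (Real.add_one_le_exp (g x - Real.log (P x / Q x))) hx.le
  linarith

lemma log_two_mul_sum_le_relEntropy_add_sum (hP : ∀ x, 0 ≤ P x) (hQ : ∀ x, 0 ≤ Q x)
    (hPQ : ∀ x, Q x = 0 → P x = 0) (hPsum : ∑ x, P x = 1) (hQsum : ∑ x, Q x = 1) {f : X → ℝ}
    (hf : ∀ x, f x ∈ Set.Icc 0 1) :
    Real.log 2 * ∑ x, P x * f x ≤ relEntropy P Q + ∑ x, Q x * f x := by
  have hexp (x : X) : Real.exp (Real.log 2 * f x) ≤ 1 + f x := by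
    have := rpow_one_add_le_one_add_mul_self (s := 1) (by norm_num) (hf x).1 (hf x).2
    rwa [one_add_one_eq_two, mul_one, Real.rpow_def_of_pos two_pos] at this
  have hmean : ∑ x, Q x * Real.exp (Real.log 2 * f x) ≤ 1 + ∑ x, Q x * f x := by
    rw [← hQsum, ← Finset.sum_add_distrib]
    refine Finset.sum_le_sum fun x _ ↦ ?_
    rw [← mul_one_add]
    exact mul_le_mul_of_nonneg_left (hexp x) (hQ x)
  have hgibbs := sum_mul_add_one_le_relEntropy_add_sum_exp hP hQ hPQ hPsum fun x ↦ Real.log 2 * f x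
  simp_rw [mul_left_comm _ (Real.log 2), ← Finset.mul_sum] at hgibbs
  linarith

lemma relEntropy_le_sum_sq_div (hP : ∀ x, 0 ≤ P x) (hQ : ∀ x, 0 < Q x)
    (hsum : ∑ x, P x = ∑ x, Q x) : relEntropy P Q ≤ ∑ x, (P x - Q x) ^ 2 / Q x := by
  have hterm (x : X) : P x * Real.log (P x / Q x) ≤ (P x - Q x) ^ 2 / Q x + (P x - Q x) := by
    calc P x * Real.log (P x / Q x) ≤ P x * (P x / Q x - 1) := by
          rcases (hP x).eq_or_lt with hx | hx
          · simp [← hx]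
          · exact mul_le_mul_of_nonneg_left
              (Real.log_le_sub_one_of_pos (div_pos hx (hQ x))) hx.le
      _ = (P x - Q x) ^ 2 / Q x + (P x - Q x) := by
          have := (hQ x).ne'
          field_simp
          ring
  calc relEntropy P Q ≤ ∑ x, ((P x - Q x) ^ 2 / Q x + (P x - Q x)) :=
        Finset.sum_le_sum fun x _ ↦ hterm x
    _ = ∑ x, (P x - Q x) ^ 2 / Q x := by
        rw [Finset.sum_add_distrib, Finset.sum_sub_distrib, hsum, sub_self, add_zero]

end RelativeEntropy

section Bernoulli

variable {T : ℕ}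

/-- The Bernoulli probability weights with mean `m`. -/
def bern (m : ℝ) (x : Bool) : ℝ := if x then m else 1 - m

/-- The binary losses as elements of `[0, 1]`. -/
def bit (x : Bool) : unitInterval := if x then 1 else 0

lemma sum_bern (m : ℝ) : ∑ x, bern m x = 1 := by simp [bern]

lemma sum_bern_mul_bit (m : ℝ) : ∑ x, bern m x * (bit x : ℝ) = m := by simp [bern, bit]

lemma bern_nonneg {m : ℝ} (hm : m ∈ Set.Icc 0 1) (x : Bool) : 0 ≤ bern m x := by
  cases x <;> simp [bern, hm.1, hm.2]

lemma bern_pos {m : ℝ} (hm : m ∈ Set.Ioo 0 1) (x : Bool) : 0 < bern m x := by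
  cases x <;> simp [bern, hm.1, hm.2]

lemma relEntropy_bern_le {p q : ℝ} (hp : p ∈ Set.Icc 0 1) (hq : q ∈ Set.Ioo 0 1) :
    relEntropy (bern p) (bern q) ≤ (p - q) ^ 2 / (q * (1 - q)) := by
  refine (relEntropy_le_sum_sq_div (bern_nonneg hp) (bern_pos hq)
    ((sum_bern p).trans (sum_bern q).symm)).trans_eq ?_
  have hq0 : q ≠ 0 := hq.1.ne'
  have hq1 : 1 - q ≠ 0 := (sub_pos.2 hq.2).ne'
  simp only [bern, Fintype.sum_bool, if_true, Bool.false_eq_true, if_false]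
  field_simp
  ring

lemma sum_prod_bern_mul_sum_bit (m : ℝ) :
    ∑ x : Fin T → Bool, (∏ t, bern m (x t)) * ∑ t, (bit (x t) : ℝ) = T * m := by
  have hκ : ∀ (t : Fin T) (_ : Fin t → Bool), ∑ y, bern m y = 1 := fun _ _ ↦ sum_bern m
  refine (sum_pathWeight_mul_sum_eq_condMean hκ fun _ _ y ↦ (bit y : ℝ)).trans ?_
  simp_rw [sum_bern_mul_bit, ← Finset.sum_mul, sum_pathWeight hκ]
  simp

lemma sum_prod_bern_mul_two_rpow_sum_bit_le {m : ℝ} (hm : 0 ≤ m) :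
    ∑ x : Fin T → Bool, (∏ t, bern m (x t)) * (2 : ℝ) ^ ∑ t, (bit (x t) : ℝ) ≤
      Real.exp (T * m) := by
  have hone : ∑ y, bern m y * (2 : ℝ) ^ (bit y : ℝ) = m + 1 := by
    simp [bern, bit]
    ring
  calc ∑ x : Fin T → Bool, (∏ t, bern m (x t)) * (2 : ℝ) ^ ∑ t, (bit (x t) : ℝ)
      = ∏ _t : Fin T, ∑ y, bern m y * (2 : ℝ) ^ (bit y : ℝ) := by
        simp_rw [Fintype.prod_sum, Finset.prod_mul_distrib, Real.rpow_sum_of_pos two_pos]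
    _ = (m + 1) ^ T := by
        rw [hone, Finset.prod_const, Finset.card_univ, Fintype.card_fin]
    _ ≤ Real.exp m ^ T := pow_le_pow_left₀ (by linarith) (Real.add_one_le_exp m) T
    _ = Real.exp (T * m) := (Real.exp_nat_mul m T).symm

lemma sum_prod_bern_mul_ite_lt_le {m : ℝ} (hm : m ∈ Set.Icc 0 1) (b : ℝ) :
    ∑ x : Fin T → Bool, (∏ t, bern m (x t)) * (if b < ∑ t, (bit (x t) : ℝ) then 1 else 0) ≤
      Real.exp (T * m - b * Real.log 2) := by
  have hmarkov (s : ℝ) : (if b < s then (1 : ℝ) else 0) ≤ 2 ^ s * 2 ^ (-b) := by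
    rw [← Real.rpow_add two_pos]
    split_ifs with h
    · exact Real.one_le_rpow one_le_two (by linarith)
    · positivity
  calc ∑ x : Fin T → Bool, (∏ t, bern m (x t)) * (if b < ∑ t, (bit (x t) : ℝ) then 1 else 0)
      ≤ ∑ x : Fin T → Bool, (∏ t, bern m (x t)) * (2 ^ (∑ t, (bit (x t) : ℝ)) * 2 ^ (-b)) :=
        Finset.sum_le_sum fun x _ ↦ mul_le_mul_of_nonneg_left (hmarkov _)
          (Finset.prod_nonneg fun t _ ↦ bern_nonneg hm (x t))
    _ = (∑ x : Fin T → Bool, (∏ t, bern m (x t)) * 2 ^ ∑ t, (bit (x t) : ℝ)) * 2 ^ (-b) := by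
        simp_rw [← mul_assoc, ← Finset.sum_mul]
    _ ≤ Real.exp (T * m) * 2 ^ (-b) :=
        mul_le_mul_of_nonneg_right (sum_prod_bern_mul_two_rpow_sum_bit_le hm.1) (by positivity)
    _ = Real.exp (T * m - b * Real.log 2) := by
        rw [Real.rpow_def_of_pos two_pos, ← Real.exp_add]
        ring_nf

end Bernoulli

section Regret

variable {K T : ℕ}

lemma bestLoss_le (ℓ : LossSeq K T) (i : Fin K) : bestLoss ℓ ≤ ∑ t, (ℓ t i : ℝ) :=
  ciInf_le (Set.finite_range _).bddBelow i

lemma bestLoss_nonneg (ℓ : LossSeq K T) : 0 ≤ bestLoss ℓ :=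
  Real.iInf_nonneg fun _ ↦ Finset.sum_nonneg fun _ _ ↦ unitInterval.nonneg _

lemma regret_le (ℓ : LossSeq K T) (a : Fin T → Fin K) : regret ℓ a ≤ T := by
  have hsum : ∑ t, (ℓ t (a t) : ℝ) ≤ ∑ _t : Fin T, (1 : ℝ) :=
    Finset.sum_le_sum fun _ _ ↦ unitInterval.le_one _
  rw [Fin.sum_const, nsmul_one] at hsum
  exact sub_le_self_iff _ |>.2 (bestLoss_nonneg ℓ) |>.trans hsum

namespace RandomisedAlgorithm

variable (A : RandomisedAlgorithm K) (ℓ : LossSeq K T) (ω : A.Ω) (a : Fin T → Fin K)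

lemma playProb_nonneg : 0 ≤ A.playProb ℓ ω a :=
  Finset.prod_nonneg fun _ _ ↦ A.weight_nonneg _ _ _ _

lemma sum_playProb : ∑ a, A.playProb ℓ ω a = 1 :=
  sum_pathWeight (κ := fun (t : Fin T) a k ↦
    A.weight t ω (fun s ↦ (a s, ℓ (s.castLE t.isLt.le) (a s))) k) fun _ _ ↦ A.weight_sum _ _ _

lemma playProb_le_one : A.playProb ℓ ω a ≤ 1 := by
  rw [← A.sum_playProb ℓ ω]
  exact Finset.single_le_sum (fun a _ ↦ A.playProb_nonneg ℓ ω a) (Finset.mem_univ a)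

lemma integrable_playProb : Integrable (fun ω ↦ A.playProb ℓ ω a) A.P := by
  refine Integrable.of_bound (Finset.measurable_prod _ fun _ _ ↦
    A.weight_measurable _ _ _).aestronglyMeasurable 1 (ae_of_all _ fun ω ↦ ?_)
  rw [Real.norm_of_nonneg (A.playProb_nonneg ℓ ω a)]
  exact A.playProb_le_one ℓ ω a

/-- The expected regret given the seed: the integrand of `expectedRegret`. -/
def seedRegret : ℝ := ∑ a, A.playProb ℓ ω a * regret ℓ a

lemma integrable_seedRegret : Integrable (A.seedRegret ℓ) A.P :=
  integrable_finsetSum _ fun a _ ↦ (A.integrable_playProb ℓ a).mul_const _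

lemma expectedRegret_eq_integral : A.expectedRegret ℓ = ∫ ω, A.seedRegret ℓ ω ∂A.P := rfl

lemma seedRegret_le : A.seedRegret ℓ ω ≤ T :=
  calc A.seedRegret ℓ ω ≤ ∑ a, A.playProb ℓ ω a * (T : ℝ) :=
        Finset.sum_le_sum fun a _ ↦
          mul_le_mul_of_nonneg_left (regret_le ℓ a) (A.playProb_nonneg ℓ ω a)
    _ = T := by rw [← Finset.sum_mul, A.sum_playProb, one_mul]

lemma expectedRegret_le : A.expectedRegret ℓ ≤ T :=
  calc A.expectedRegret ℓ ≤ ∫ _ω, (T : ℝ) ∂A.P :=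
        integral_mono (A.integrable_seedRegret ℓ) (integrable_const _) (A.seedRegret_le ℓ)
    _ = T := by simp

lemma sum_playProb_mul_sum_sub_le_seedRegret (i : Fin K) :
    ∑ a, A.playProb ℓ ω a * ∑ t, (ℓ t (a t) : ℝ) - ∑ t, (ℓ t i : ℝ) ≤ A.seedRegret ℓ ω :=
  calc ∑ a, A.playProb ℓ ω a * ∑ t, (ℓ t (a t) : ℝ) - ∑ t, (ℓ t i : ℝ)
      = ∑ a, A.playProb ℓ ω a * (∑ t, (ℓ t (a t) : ℝ) - ∑ t, (ℓ t i : ℝ)) := by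
        simp_rw [mul_sub, Finset.sum_sub_distrib, ← Finset.sum_mul, A.sum_playProb, one_mul]
    _ ≤ A.seedRegret ℓ ω := Finset.sum_le_sum fun a _ ↦ mul_le_mul_of_nonneg_left
        (sub_le_sub_left (bestLoss_le _ i) _) (A.playProb_nonneg _ _ _)

end RandomisedAlgorithm

end Regret

section RandomTable

variable {K T : ℕ} {m : Fin K → ℝ}

/-- The probability of the table `v` of binary losses when its entries are independent and the
losses of arm `j` have mean `m j`. -/
def tableProb (m : Fin K → ℝ) (v : Fin T × Fin K → Bool) : ℝ := ∏ s, bern (m s.2) (v s)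

/-- The loss sequence given by a table of binary losses. -/
def tableLoss (v : Fin T × Fin K → Bool) : LossSeq K T := fun t i ↦ bit (v (t, i))

lemma tableProb_nonneg (hm : ∀ j, m j ∈ Set.Icc 0 1) (v : Fin T × Fin K → Bool) :
    0 ≤ tableProb m v :=
  Finset.prod_nonneg fun _ _ ↦ bern_nonneg (hm _) _

lemma sum_tableProb (m : Fin K → ℝ) : ∑ v : Fin T × Fin K → Bool, tableProb m v = 1 := by
  simp_rw [tableProb, ← Fintype.prod_sum fun (s : Fin T × Fin K) x ↦ bern (m s.2) x, sum_bern,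
    Finset.prod_const_one]

lemma sum_tableProb_mul_comp (m : Fin K → ℝ) (a : Fin T → Fin K) (F : (Fin T → Bool) → ℝ) :
    ∑ v, tableProb m v * F (fun t ↦ v (t, a t)) =
      ∑ x : Fin T → Bool, (∏ t, bern (m (a t)) (x t)) * F x :=
  sum_prod_mul_comp (w := fun s : Fin T × Fin K ↦ bern (m s.2)) (fun _ ↦ sum_bern _)
    (e := fun t ↦ (t, a t)) (fun _ _ h ↦ congrArg Prod.fst h) F

lemma sum_tableProb_mul_sum_tableLoss (m : Fin K → ℝ) (i : Fin K) :
    ∑ v : Fin T × Fin K → Bool, tableProb m v * ∑ t, (tableLoss v t i : ℝ) = T * m i :=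
  (sum_tableProb_mul_comp m (fun _ ↦ i) fun x ↦ ∑ t, (bit (x t) : ℝ)).trans
    (sum_prod_bern_mul_sum_bit (m i))

lemma sum_tableProb_mul_ite_lt_le (hm : ∀ j, m j ∈ Set.Icc 0 1) (i : Fin K) (b : ℝ) :
    ∑ v : Fin T × Fin K → Bool,
        tableProb m v * (if b < ∑ t, (tableLoss v t i : ℝ) then 1 else 0) ≤
      Real.exp (T * m i - b * Real.log 2) :=
  (sum_tableProb_mul_comp m (fun _ ↦ i)
    fun x ↦ if b < ∑ t, (bit (x t) : ℝ) then 1 else 0).trans_le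
      (sum_prod_bern_mul_ite_lt_le (hm i) b)

end RandomTable

section Observations

variable {K T : ℕ}

/-- The number of rounds in which arm `i` is played. -/
def plays (i : Fin K) (h : Fin T → Fin K × Bool) : ℝ := ∑ t, if (h t).1 = i then 1 else 0

lemma plays_nonneg (i : Fin K) (h : Fin T → Fin K × Bool) : 0 ≤ plays i h :=
  Finset.sum_nonneg fun t _ ↦ by split_ifs <;> norm_num

lemma sum_plays_mul (h : Fin T → Fin K × Bool) (c : Fin K → ℝ) :
    ∑ i, plays i h * c i = ∑ t, c (h t).1 := by
  simp_rw [plays, Finset.sum_mul, ite_mul, one_mul, zero_mul]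
  rw [Finset.sum_comm]
  simp

lemma sum_plays (h : Fin T → Fin K × Bool) : ∑ i, plays i h = T := by
  simpa using sum_plays_mul h fun _ ↦ 1

lemma plays_le (i : Fin K) (h : Fin T → Fin K × Bool) : plays i h ≤ T :=
  (Finset.single_le_sum (fun j _ ↦ plays_nonneg j h) (Finset.mem_univ i)).trans_eq (sum_plays h)

namespace RandomisedAlgorithm

variable (A : RandomisedAlgorithm K) (ω : A.Ω) (m : Fin K → ℝ)

/-- The weights of the next arm played and the loss it incurs, given the arms played and the losses
observed so far, when the losses of arm `j` are Bernoulli variables with mean `m j`. -/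
def obsKernel (t : ℕ) (g : Fin t → Fin K × Bool) (y : Fin K × Bool) : ℝ :=
  A.weight t ω (fun s ↦ ((g s).1, bit (g s).2)) y.1 * bern (m y.1) y.2

/-- The probability that `h` is the sequence of arms played and losses observed, when the losses of
arm `j` are independent Bernoulli variables with mean `m j`. -/
def obsProb (h : Fin T → Fin K × Bool) : ℝ := pathWeight (fun t : Fin T ↦ A.obsKernel ω m t) h

/-- The expected number of plays of arm `i` in `T` rounds under `obsProb`. -/
def expectedPlays (T : ℕ) (i : Fin K) : ℝ :=
  ∑ h : Fin T → Fin K × Bool, A.obsProb ω m h * plays i h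

lemma sum_obsKernel_mul (t : ℕ) (g : Fin t → Fin K × Bool) (f : Fin K × Bool → ℝ) :
    ∑ y, A.obsKernel ω m t g y * f y =
      ∑ a, A.weight t ω (fun s ↦ ((g s).1, bit (g s).2)) a * ∑ x, bern (m a) x * f (a, x) := by
  rw [Fintype.sum_prod_type]
  simp_rw [obsKernel, mul_assoc, ← Finset.mul_sum]

lemma sum_obsKernel (t : ℕ) (g : Fin t → Fin K × Bool) : ∑ y, A.obsKernel ω m t g y = 1 := by
  simpa only [mul_one, sum_bern, A.weight_sum] using A.sum_obsKernel_mul ω m t g fun _ ↦ 1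

lemma obsProb_nonneg {m : Fin K → ℝ} (hm : ∀ j, m j ∈ Set.Icc 0 1) (h : Fin T → Fin K × Bool) :
    0 ≤ A.obsProb ω m h :=
  pathWeight_nonneg
    (fun _ _ _ ↦ mul_nonneg (A.weight_nonneg _ _ _ _) (bern_nonneg (hm _) _)) h

lemma sum_obsProb : ∑ h : Fin T → Fin K × Bool, A.obsProb ω m h = 1 :=
  sum_pathWeight fun t ↦ A.sum_obsKernel ω m t

lemma obsProb_eq_mul (h : Fin T → Fin K × Bool) :
    A.obsProb ω m h =
      (∏ t : Fin T, A.weight t ω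
        (fun s ↦ ((Fin.take t t.isLt.le h s).1, bit (Fin.take t t.isLt.le h s).2)) (h t).1) *
        ∏ t, bern (m (h t).1) (h t).2 := by
  simp only [obsProb, pathWeight, obsKernel, Finset.prod_mul_distrib]

lemma expectedPlays_nonneg {m : Fin K → ℝ} (hm : ∀ j, m j ∈ Set.Icc 0 1) (i : Fin K) :
    0 ≤ A.expectedPlays ω m T i :=
  Finset.sum_nonneg fun h _ ↦ mul_nonneg (A.obsProb_nonneg ω hm h) (plays_nonneg i h)

lemma sum_expectedPlays : ∑ i, A.expectedPlays ω m T i = T := by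
  simp_rw [expectedPlays]
  rw [Finset.sum_comm]
  simp_rw [← Finset.mul_sum, sum_plays, ← Finset.sum_mul, sum_obsProb, one_mul]

lemma sum_obsProb_mul_sum_eq_sum_expectedPlays_mul (f : Fin K × Bool → ℝ) :
    ∑ h : Fin T → Fin K × Bool, A.obsProb ω m h * ∑ t, f (h t) =
      ∑ j, A.expectedPlays ω m T j * ∑ x, bern (m j) x * f (j, x) := by
  set c : Fin K → ℝ := fun j ↦ ∑ x, bern (m j) x * f (j, x)
  have hcond (t : ℕ) (g : Fin t → Fin K × Bool) :
      ∑ y, A.obsKernel ω m t g y * f y = ∑ y, A.obsKernel ω m t g y * c y.1 := by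
    simp_rw [sum_obsKernel_mul, ← Finset.sum_mul, sum_bern, one_mul, c]
  have hκ (t : Fin T) := A.sum_obsKernel ω m t
  calc ∑ h : Fin T → Fin K × Bool, A.obsProb ω m h * ∑ t, f (h t)
      = ∑ h : Fin T → Fin K × Bool, A.obsProb ω m h * ∑ t, c (h t).1 := by
        refine (sum_pathWeight_mul_sum_eq_condMean hκ fun _ _ y ↦ f y).trans ?_
        simp_rw [hcond]
        exact (sum_pathWeight_mul_sum_eq_condMean hκ fun _ _ y ↦ c y.1).symm
    _ = ∑ j, A.expectedPlays ω m T j * c j := by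
        simp_rw [← sum_plays_mul, expectedPlays, Finset.mul_sum, Finset.sum_mul, mul_assoc]
        exact Finset.sum_comm

lemma relEntropy_obsProb {m' : Fin K → ℝ} (hm' : ∀ j, m' j ∈ Set.Ioo 0 1) :
    relEntropy (A.obsProb (T := T) ω m) (A.obsProb ω m') =
      ∑ j, A.expectedPlays ω m T j * relEntropy (bern (m j)) (bern (m' j)) := by
  refine (Finset.sum_congr rfl fun h _ ↦ ?_).trans
    (A.sum_obsProb_mul_sum_eq_sum_expectedPlays_mul ω m
      fun y ↦ Real.log (bern (m y.1) y.2 / bern (m' y.1) y.2))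
  rcases eq_or_ne (A.obsProb ω m h) 0 with hP | hP
  · simp [hP]
  rw [obsProb_eq_mul, mul_ne_zero_iff, Finset.prod_ne_zero_iff (f := fun t ↦ bern _ _)] at hP
  congr 1
  rw [obsProb_eq_mul, obsProb_eq_mul, mul_div_mul_left _ _ hP.1, ← Finset.prod_div_distrib,
    Real.log_prod fun t ht ↦ div_ne_zero (hP.2 t ht) (bern_pos (hm' _) _).ne']

lemma obsProb_eq_zero_of_obsProb_eq_zero {m' : Fin K → ℝ} (hm' : ∀ j, m' j ∈ Set.Ioo 0 1)
    {h : Fin T → Fin K × Bool} (hh : A.obsProb ω m' h = 0) : A.obsProb ω m h = 0 := by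
  rw [obsProb_eq_mul, mul_eq_zero_iff_right
    (Finset.prod_pos fun t _ ↦ bern_pos (hm' (h t).1) (h t).2).ne'] at hh
  rw [obsProb_eq_mul, hh, zero_mul]

/-- The table fixes the losses of all arms in advance, but along each sequence of arms only its
entries at the arms played matter, and these are independent. -/
lemma sum_tableProb_mul_sum_playProb (G : (Fin T → Fin K × Bool) → ℝ) :
    ∑ v, tableProb m v * ∑ a, A.playProb (tableLoss v) ω a * G (fun t ↦ (a t, v (t, a t))) =
      ∑ h, A.obsProb ω m h * G h := by
  simp_rw [Finset.mul_sum]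
  rw [Finset.sum_comm, ← (Equiv.arrowProdEquivProdArrow (Fin T) (fun _ ↦ Fin K)
    fun _ ↦ Bool).symm.sum_comp, Fintype.sum_prod_type]
  refine Finset.sum_congr rfl fun a _ ↦ (sum_tableProb_mul_comp m a fun x ↦ (∏ t : Fin T,
    A.weight t ω (fun s ↦ (a (s.castLE t.isLt.le), bit (x (s.castLE t.isLt.le)))) (a t)) *
      G fun t ↦ (a t, x t)).trans (Finset.sum_congr rfl fun x _ ↦ ?_)
  rw [obsProb_eq_mul, mul_left_comm, ← mul_assoc]
  rfl

end RandomisedAlgorithm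

end Observations

section AverageRegret

variable {K T : ℕ} {p q : ℝ}

namespace RandomisedAlgorithm

variable (A : RandomisedAlgorithm K) (ω : A.Ω)

lemma sum_sub_mul_expectedPlays_le {m : Fin K → ℝ} (hm : ∀ j, m j ∈ Set.Icc 0 1) (i : Fin K) :
    ∑ j, (m j - m i) * A.expectedPlays ω m T j ≤
      ∑ v : Fin T × Fin K → Bool, tableProb m v * A.seedRegret (tableLoss v) ω := by
  have hplayed : ∑ v : Fin T × Fin K → Bool, tableProb m v *
        ∑ a, A.playProb (tableLoss v) ω a * ∑ t, (tableLoss v t (a t) : ℝ) =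
      ∑ j, A.expectedPlays ω m T j * m j := by
    refine (A.sum_tableProb_mul_sum_playProb ω m fun h ↦ ∑ t, (bit (h t).2 : ℝ)).trans ?_
    rw [A.sum_obsProb_mul_sum_eq_sum_expectedPlays_mul ω m fun y ↦ (bit y.2 : ℝ)]
    simp_rw [sum_bern_mul_bit]
  calc ∑ j, (m j - m i) * A.expectedPlays ω m T j
      = ∑ v : Fin T × Fin K → Bool, tableProb m v *
          (∑ a, A.playProb (tableLoss v) ω a * ∑ t, (tableLoss v t (a t) : ℝ) -
            ∑ t, (tableLoss v t i : ℝ)) := by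
        simp_rw [mul_sub, Finset.sum_sub_distrib, hplayed, sum_tableProb_mul_sum_tableLoss, sub_mul,
          Finset.sum_sub_distrib, ← Finset.mul_sum, sum_expectedPlays, mul_comm]
    _ ≤ ∑ v : Fin T × Fin K → Bool, tableProb m v * A.seedRegret (tableLoss v) ω :=
        Finset.sum_le_sum fun v _ ↦ mul_le_mul_of_nonneg_left
          (A.sum_playProb_mul_sum_sub_le_seedRegret _ ω i) (tableProb_nonneg hm v)

lemma log_two_mul_sub_expectedPlays_le {m m' : Fin K → ℝ} (hm : ∀ j, m j ∈ Set.Icc 0 1)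
    (hm' : ∀ j, m' j ∈ Set.Ioo 0 1) (i : Fin K) :
    Real.log 2 * (T - A.expectedPlays ω m T i) ≤
      T * relEntropy (A.obsProb (T := T) ω m) (A.obsProb ω m') +
        (T - A.expectedPlays ω m' T i) := by
  have hmean (n : Fin K → ℝ) :
      T * ∑ h : Fin T → Fin K × Bool, A.obsProb ω n h * (1 - plays i h / T) =
        T - A.expectedPlays ω n T i := by
    have hplays (h : Fin T → Fin K × Bool) : (T : ℝ) * (plays i h / T) = plays i h :=
      mul_div_cancel_of_imp' fun h0 ↦ le_antisymm (h0 ▸ plays_le i h) (plays_nonneg i h)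
    simp_rw [Finset.mul_sum, mul_left_comm (T : ℝ), mul_sub, hplays, mul_one,
      Finset.sum_sub_distrib, ← Finset.sum_mul, sum_obsProb, one_mul, expectedPlays]
  have hfreq (h : Fin T → Fin K × Bool) : 1 - plays i h / T ∈ Set.Icc (0 : ℝ) 1 :=
    ⟨sub_nonneg.2 (div_le_one_of_le₀ (plays_le i h) T.cast_nonneg),
      sub_le_self _ (div_nonneg (plays_nonneg i h) T.cast_nonneg)⟩
  rw [← hmean m, ← hmean m', mul_left_comm, ← mul_add]
  exact mul_le_mul_of_nonneg_left (log_two_mul_sum_le_relEntropy_add_sum (A.obsProb_nonneg ω hm)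
    (A.obsProb_nonneg ω fun j ↦ Set.Ioo_subset_Icc_self (hm' j))
    (fun _ ↦ A.obsProb_eq_zero_of_obsProb_eq_zero ω m hm') (A.sum_obsProb ω m)
    (A.sum_obsProb ω m') hfreq) T.cast_nonneg

end RandomisedAlgorithm

/-- The mean losses when `i` is the planted arm, with mean `q` instead of `p`. -/
def plantedMean (p q : ℝ) (i : Fin K) : Fin K → ℝ := Function.update (fun _ ↦ p) i q

lemma plantedMean_mem {s : Set ℝ} (hp : p ∈ s) (hq : q ∈ s) (i j : Fin K) :
    plantedMean p q i j ∈ s := by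
  rcases eq_or_ne j i with rfl | hj
  · simpa [plantedMean] using hq
  · simpa [plantedMean, hj] using hp

namespace RandomisedAlgorithm

variable (A : RandomisedAlgorithm K) (ω : A.Ω)

lemma sub_mul_sub_expectedPlays_le (hp : p ∈ Set.Icc 0 1) (hq : q ∈ Set.Icc 0 1) (i : Fin K) :
    (p - q) * (T - A.expectedPlays ω (plantedMean p q i) T i) ≤
      ∑ v : Fin T × Fin K → Bool,
        tableProb (plantedMean p q i) v * A.seedRegret (tableLoss v) ω := by
  refine (Eq.le ?_).trans (A.sum_sub_mul_expectedPlays_le ω (plantedMean_mem hp hq i) i)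
  have hgap (j : Fin K) : plantedMean p q i j - plantedMean p q i i =
      (p - q) * (1 - if j = i then 1 else 0) := by
    rcases eq_or_ne j i with rfl | hj <;> simp [plantedMean, *]
  simp_rw [hgap, mul_assoc, ← Finset.mul_sum, sub_mul, one_mul, ite_mul, one_mul, zero_mul,
    Finset.sum_sub_distrib, sum_expectedPlays, Finset.sum_ite_eq', Finset.mem_univ, if_true]

lemma relEntropy_obsProb_plantedMean_le (hp : p ∈ Set.Ioo 0 1) (hq : q ∈ Set.Ioo 0 1)
    (i : Fin K) :
    relEntropy (A.obsProb (T := T) ω fun _ ↦ p) (A.obsProb ω (plantedMean p q i)) ≤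
      A.expectedPlays ω (fun _ ↦ p) T i * ((p - q) ^ 2 / (q * (1 - q))) := by
  have hp' := Set.Ioo_subset_Icc_self hp
  rw [A.relEntropy_obsProb ω _ (plantedMean_mem hp hq i), Finset.sum_eq_single i]
  · rw [plantedMean, Function.update_self]
    exact mul_le_mul_of_nonneg_left (relEntropy_bern_le hp' hq)
      (A.expectedPlays_nonneg ω (fun _ ↦ hp') i)
  · intro j _ hj
    rw [plantedMean, Function.update_of_ne hj, relEntropy_self, mul_zero]
  · simp

lemma le_sum_sum_tableProb_mul_seedRegret (hp : p ∈ Set.Ioo 0 1) (hq : q ∈ Set.Ioo 0 1)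
    (hqp : q ≤ p) :
    (p - q) * T * (Real.log 2 * (K - 1) - T * ((p - q) ^ 2 / (q * (1 - q)))) ≤
      ∑ i, ∑ v : Fin T × Fin K → Bool,
        tableProb (plantedMean p q i) v * A.seedRegret (tableLoss v) ω := by
  set d : ℝ := (p - q) ^ 2 / (q * (1 - q))
  set n : Fin K → ℝ := A.expectedPlays ω (fun _ ↦ p) T
  have hp' := Set.Ioo_subset_Icc_self hp
  have hq' := Set.Ioo_subset_Icc_self hq
  have harm (i : Fin K) : (p - q) * (Real.log 2 * (T - n i) - T * (n i * d)) ≤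
      ∑ v : Fin T × Fin K → Bool,
        tableProb (plantedMean p q i) v * A.seedRegret (tableLoss v) ω := by
    refine (mul_le_mul_of_nonneg_left ?_ (sub_nonneg.2 hqp)).trans
      (A.sub_mul_sub_expectedPlays_le ω hp' hq' i)
    have hchange := A.log_two_mul_sub_expectedPlays_le (T := T) ω (fun _ ↦ hp')
      (plantedMean_mem hp hq i) i
    have hkl := mul_le_mul_of_nonneg_left
      (A.relEntropy_obsProb_plantedMean_le (T := T) ω hp hq i) T.cast_nonneg
    linarith
  have hn : ∑ i, n i = T := A.sum_expectedPlays ω _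
  calc (p - q) * T * (Real.log 2 * (K - 1) - T * d)
      = ∑ i, (p - q) * (Real.log 2 * (T - n i) - T * (n i * d)) := by
        simp_rw [← Finset.mul_sum, Finset.sum_sub_distrib, ← Finset.mul_sum,
          Finset.sum_sub_distrib, ← Finset.sum_mul, hn, Fin.sum_const, nsmul_eq_mul]
        ring
    _ ≤ _ := Finset.sum_le_sum fun i _ ↦ harm i

lemma le_sum_sum_tableProb_mul_expectedRegret (hp : p ∈ Set.Ioo 0 1) (hq : q ∈ Set.Ioo 0 1)
    (hqp : q ≤ p) :
    (p - q) * T * (Real.log 2 * (K - 1) - T * ((p - q) ^ 2 / (q * (1 - q)))) ≤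
      ∑ i, ∑ v : Fin T × Fin K → Bool,
        tableProb (plantedMean p q i) v * A.expectedRegret (tableLoss v) := by
  have hint (i : Fin K) (v : Fin T × Fin K → Bool) :
      Integrable (fun ω ↦ tableProb (plantedMean p q i) v * A.seedRegret (tableLoss v) ω) A.P :=
    (A.integrable_seedRegret _).const_mul _
  have hint_sum (i : Fin K) := integrable_finsetSum Finset.univ fun v _ ↦ hint i v
  calc _ = ∫ _ω, (p - q) * T * (Real.log 2 * (K - 1) - T * ((p - q) ^ 2 / (q * (1 - q)))) ∂A.P := by
        simp
    _ ≤ ∫ ω, ∑ i, ∑ v : Fin T × Fin K → Bool,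
          tableProb (plantedMean p q i) v * A.seedRegret (tableLoss v) ω ∂A.P :=
        integral_mono (integrable_const _) (integrable_finsetSum _ fun i _ ↦ hint_sum i)
          fun ω ↦ A.le_sum_sum_tableProb_mul_seedRegret ω hp hq hqp
    _ = ∑ i, ∑ v : Fin T × Fin K → Bool,
          tableProb (plantedMean p q i) v * A.expectedRegret (tableLoss v) := by
        simp_rw [integral_finsetSum _ fun i _ ↦ hint_sum i,
          integral_finsetSum _ fun v _ ↦ hint _ v, integral_const_mul, expectedRegret_eq_integral]

end RandomisedAlgorithm

end AverageRegret

section SmallLossBall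

namespace RandomisedAlgorithm

variable {K T : ℕ} (A : RandomisedAlgorithm K) {α B : ℝ}

lemma bddAbove_expectedRegret_image (s : Set (LossSeq K T)) :
    BddAbove ((fun ℓ ↦ A.expectedRegret ℓ) '' s) :=
  ⟨T, Set.forall_mem_image.2 fun ℓ _ ↦ A.expectedRegret_le ℓ⟩

lemma sum_tableProb_mul_expectedRegret_le (hT : 0 < T) (hB : 0 ≤ B)
    (hAB : ∀ ℓ ∈ smallLossBall K T α, A.expectedRegret ℓ ≤ B) {m : Fin K → ℝ}
    (hm : ∀ j, m j ∈ Set.Icc 0 1) (i : Fin K) :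
    ∑ v : Fin T × Fin K → Bool, tableProb m v * A.expectedRegret (tableLoss v) ≤
      B + T * Real.exp (T * m i - α * T * Real.log 2) := by
  have hpointwise (v : Fin T × Fin K → Bool) : A.expectedRegret (tableLoss v) ≤
      B + T * (if α * T < ∑ t, (tableLoss v t i : ℝ) then 1 else 0) := by
    split_ifs with h
    · linarith [A.expectedRegret_le (tableLoss v)]
    · have hball : tableLoss v ∈ smallLossBall K T α :=
        (div_le_iff₀ (Nat.cast_pos.2 hT)).2 ((bestLoss_le _ i).trans (not_lt.1 h))
      linarith [hAB _ hball]
  calc ∑ v : Fin T × Fin K → Bool, tableProb m v * A.expectedRegret (tableLoss v)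
      ≤ ∑ v : Fin T × Fin K → Bool, tableProb m v *
          (B + T * (if α * T < ∑ t, (tableLoss v t i : ℝ) then 1 else 0)) :=
        Finset.sum_le_sum fun v _ ↦
          mul_le_mul_of_nonneg_left (hpointwise v) (tableProb_nonneg hm v)
    _ = B + T * ∑ v : Fin T × Fin K → Bool, tableProb m v *
          (if α * T < ∑ t, (tableLoss v t i : ℝ) then 1 else 0) := by
        simp_rw [mul_add, Finset.sum_add_distrib, ← Finset.sum_mul, sum_tableProb, one_mul,
          mul_left_comm _ (T : ℝ), ← Finset.mul_sum]
    _ ≤ B + T * Real.exp (T * m i - α * T * Real.log 2) := by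
        gcongr
        exact sum_tableProb_mul_ite_lt_le hm i _

lemma exists_mem_smallLossBall_lt_expectedRegret {p q : ℝ} (hT : 0 < T) (hB : 0 ≤ B)
    (hp : p ∈ Set.Ioo 0 1) (hq : q ∈ Set.Ioo 0 1) (hqp : q ≤ p)
    (hgap : K * (B + T * Real.exp (T * q - α * T * Real.log 2)) <
      (p - q) * T * (Real.log 2 * (K - 1) - T * ((p - q) ^ 2 / (q * (1 - q))))) :
    ∃ ℓ ∈ smallLossBall K T α, B < A.expectedRegret ℓ := by
  by_contra! hAB
  have hupper (i : Fin K) : ∑ v : Fin T × Fin K → Bool,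
        tableProb (plantedMean p q i) v * A.expectedRegret (tableLoss v) ≤
      B + T * Real.exp (T * q - α * T * Real.log 2) := by
    have hm := plantedMean_mem (Set.Ioo_subset_Icc_self hp) (Set.Ioo_subset_Icc_self hq) i
    simpa [plantedMean] using A.sum_tableProb_mul_expectedRegret_le hT hB hAB hm i
  refine ((A.le_sum_sum_tableProb_mul_expectedRegret hp hq hqp).trans
    (Finset.sum_le_sum fun i _ ↦ hupper i)).not_gt ?_
  rwa [Fin.sum_const, nsmul_eq_mul]

end RandomisedAlgorithm

end SmallLossBall

section Calibration

variable {α x k c : ℝ}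

/-- By how much the mean loss of the planted arm is below the mean loss `α / 2` of the other arms,
for `k` arms and `x` rounds. -/
def gap (α x k : ℝ) : ℝ := √(α * x * k) / (6 * x)

lemma eight_le_log (hx : 118 ≤ x) : 8 ≤ Real.log (32 * x) := by
  rw [Real.le_log_iff_exp_le (by linarith)]
  calc Real.exp 8 = Real.exp 1 ^ 8 := by
        rw [← Real.exp_nat_mul]
        norm_num
    _ ≤ 2.7182818286 ^ 8 :=
        pow_le_pow_left₀ (Real.exp_pos 1).le Real.exp_one_lt_d9.le 8
    _ ≤ 32 * 118 := by norm_num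
    _ ≤ 32 * x := by gcongr

lemma mul_exp_le {q : ℝ} (hx : 118 ≤ x) (hq : q ≤ α / 2)
    (hα : 64 / 9 * Real.log (32 * x) ≤ α * x) :
    x * Real.exp (x * q - α * x * Real.log 2) ≤ 1 / 32 := by
  have hx₀ : 0 < x := by linarith
  have hlog := eight_le_log hx
  have hlog2 : 9 / 64 ≤ Real.log 2 - 1 / 2 := by linarith [Real.log_two_gt_d9]
  have hexponent : x * q - α * x * Real.log 2 ≤ -Real.log (32 * x) :=
    calc x * q - α * x * Real.log 2 ≤ x * (α / 2) - α * x * Real.log 2 :=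
          sub_le_sub_right (mul_le_mul_of_nonneg_left hq hx₀.le) _
      _ = -((Real.log 2 - 1 / 2) * (α * x)) := by ring
      _ ≤ -(9 / 64 * (64 / 9 * Real.log (32 * x))) := by gcongr
      _ = -Real.log (32 * x) := by ring
  calc x * Real.exp (x * q - α * x * Real.log 2) ≤ x * Real.exp (-Real.log (32 * x)) := by gcongr
    _ = 1 / 32 := by
      rw [Real.exp_neg, Real.exp_log (by linarith)]
      field_simp

lemma gap_nonneg (α : ℝ) (hx : 0 < x) : 0 ≤ gap α x k := by
  unfold gap
  positivity

lemma gap_sq (hα : 0 ≤ α) (hx : 0 < x) (hk : 0 ≤ k) : gap α x k ^ 2 = α * k / (36 * x) := by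
  rw [gap, div_pow, Real.sq_sqrt (by positivity)]
  field_simp
  norm_num

lemma gap_le (hα : 0 ≤ α) (hx : 0 < x) (hc : 0 ≤ c) (hk : k ≤ c ^ 2 * (α * x)) :
    gap α x k ≤ c / 6 * α := by
  have hsqrt : √(α * x * k) ≤ c * (α * x) :=
    Real.sqrt_le_iff.2 ⟨by positivity, by
      calc α * x * k ≤ α * x * (c ^ 2 * (α * x)) := by gcongr
        _ = (c * (α * x)) ^ 2 := by ring⟩
  rw [gap, div_le_iff₀ (by positivity)]
  linarith

lemma mul_gap_sq_div_le (hα : 0 < α) (hα' : α ≤ 1 / 2) (hx : 0 < x) (hk₀ : 0 ≤ k) (hc₀ : 0 ≤ c)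
    (hc : c < 3) (hk : k ≤ c ^ 2 * (α * x)) :
    x * (gap α x k ^ 2 / ((α / 2 - gap α x k) * (1 - (α / 2 - gap α x k)))) ≤
      2 * k / (9 * (3 - c)) := by
  have hgap₀ := gap_nonneg (k := k) α hx
  have hgap := gap_le hα.le hx hc₀ hk
  have hc' : 0 < 3 - c := sub_pos.2 hc
  set q := α / 2 - gap α x k with hq
  have hvar : (3 - c) / 6 * α * (3 / 4) ≤ q * (1 - q) :=
    mul_le_mul (by linarith) (by linarith) (by norm_num) (by nlinarith)
  calc x * (gap α x k ^ 2 / (q * (1 - q))) = α * k / 36 / (q * (1 - q)) := by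
        rw [gap_sq hα.le hx hk₀]
        field_simp
    _ ≤ α * k / 36 / ((3 - c) / 6 * α * (3 / 4)) :=
        div_le_div_of_nonneg_left (by positivity) (by positivity) hvar
    _ = 2 * k / (9 * (3 - c)) := by
        field_simp
        ring

lemma div_four_le_sub_mul_gap_sq_div (hα : 0 < α) (hα' : α ≤ 1 / 2) (hx : 0 < x) (hk : 2 ≤ k)
    (hαx : 56 ≤ α * x) (hαk : k / 2 ≤ α * x) :
    k / 4 ≤ Real.log 2 * (k - 1) -
      x * (gap α x k ^ 2 / ((α / 2 - gap α x k) * (1 - (α / 2 - gap α x k)))) := by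
  have hlog : 0.6931 * (k - 1) ≤ Real.log 2 * (k - 1) :=
    mul_le_mul_of_nonneg_right (by linarith [Real.log_two_gt_d9]) (by linarith)
  -- For few arms `α * x ≥ 56` makes the gap at most `α / 24`; for many arms `α / 4` is good enough.
  rcases le_total k 3 with hk₃ | hk₃
  · have hdiv := (mul_gap_sq_div_le (k := k) (c := 1 / 4) hα hα' hx (by linarith) (by norm_num)
      (by norm_num) (by linarith)).trans_eq (show _ = 8 / 99 * k by ring)
    linarith
  · have hdiv := (mul_gap_sq_div_le (k := k) (c := 3 / 2) hα hα' hx (by linarith) (by norm_num)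
      (by norm_num) (by linarith)).trans_eq (show _ = 4 / 27 * k by ring)
    linarith

lemma half_sub_gap_mem_Ioo (hα : 0 < α) (hα' : α ≤ 1 / 2) (hx : 0 < x) (hk : k / 2 ≤ α * x) :
    α / 2 - gap α x k ∈ Set.Ioo 0 1 := by
  have hgap := gap_le (k := k) (c := 3 / 2) hα.le hx (by norm_num)
    (by linarith [mul_pos hα hx])
  constructor <;> linarith [gap_nonneg (k := k) α hx]

lemma mul_add_mul_exp_lt_gap_mul (hx : 118 ≤ x) (hk : 2 ≤ k)
    (hlog : 64 / 9 * Real.log (32 * x) ≤ α * x) (hαk : k / 2 ≤ α * x) (hα : α ≤ 1 / 2) :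
    k * (√(α * x * k) / 27 + x * Real.exp (x * (α / 2 - gap α x k) - α * x * Real.log 2)) <
      gap α x k * x * (Real.log 2 * (k - 1) -
        x * (gap α x k ^ 2 / ((α / 2 - gap α x k) * (1 - (α / 2 - gap α x k))))) := by
  have hx₀ : 0 < x := by linarith
  have hαx : 56 ≤ α * x := by linarith [eight_le_log hx]
  have hα₀ : 0 < α := pos_of_mul_pos_left (by linarith) hx₀.le
  have hsqrt : 10 ≤ √(α * x * k) := Real.le_sqrt_of_sq_le (by nlinarith)
  have hgap : gap α x k * x = √(α * x * k) / 6 := by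
    rw [gap]
    field_simp
  have hexp := mul_exp_le hx (sub_le_self (α / 2) (gap_nonneg (k := k) α hx₀)) hlog
  rw [hgap]
  calc k * (√(α * x * k) / 27 + x * Real.exp (x * (α / 2 - gap α x k) - α * x * Real.log 2))
      ≤ k * (√(α * x * k) / 27 + 1 / 32) := by gcongr
    _ < k * (√(α * x * k) / 24) := by
        gcongr
        linarith
    _ = √(α * x * k) / 6 * (k / 4) := by ring
    _ ≤ _ := by
        gcongr
        exact div_four_le_sub_mul_gap_sq_div hα₀ hα hx₀ hk hαx hαk

end Calibration

end Bandit

end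

theorem theorem3 (K T : ℕ) (hK : 2 ≤ K) (hT : max K 118 ≤ T) (α : ℝ)
    (hα : α ∈ Set.Icc (max (64 / 9 * Real.log (32 * (T : ℝ))) ((K : ℝ) / 2) / (T : ℝ)) (1 / 2))
    (A : Bandit.RandomisedAlgorithm K) :
    Real.sqrt (α * (T : ℝ) * (K : ℝ)) / 27 ≤
      sSup ((fun ℓ : Bandit.LossSeq K T => A.expectedRegret ℓ) '' Bandit.smallLossBall K T α) := by
  have hK' : (2 : ℝ) ≤ K := mod_cast hK
  have hT' : (118 : ℝ) ≤ T := mod_cast (le_max_right K 118).trans hT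
  have hT₀ : (0 : ℝ) < T := by linarith
  have hαT := (div_le_iff₀ hT₀).1 hα.1
  have hlog := (le_max_left _ _).trans hαT
  have hαK := (le_max_right _ _).trans hαT
  have hα₀ : 0 < α := pos_of_mul_pos_left (by linarith) hT₀.le
  obtain ⟨ℓ, hℓ, hlt⟩ := A.exists_mem_smallLossBall_lt_expectedRegret (α := α)
    (B := √(α * T * K) / 27) (p := α / 2) (q := α / 2 - Bandit.gap α T K) (Nat.cast_pos.1 hT₀)
    (by positivity) ⟨by linarith, by linarith [hα.2]⟩
    (Bandit.half_sub_gap_mem_Ioo hα₀ hα.2 hT₀ hαK) (sub_le_self _ (Bandit.gap_nonneg α hT₀))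
    (by simpa only [sub_sub_cancel] using
      Bandit.mul_add_mul_exp_lt_gap_mul hT' hK' hlog hαK hα.2)
  exact hlt.le.trans (le_csSup (A.bddAbove_expectedRegret_image _) ⟨ℓ, hℓ, rfl⟩)
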